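/- Let $\mathbb{P}$ be a countable set of propositional variables. Formulas of dynamic probability logic ($\mathsf{DPL}$) are given by the grammar $$\varphi ::= p \mid \neg\varphi \mid \varphi\wedge\varphi \mid L_r\varphi \mid \bigcirc\varphi \qquad (p\in\mathbb{P},\ r\in\mathbb{Q}\cap[0,1]).$$ A dynamic Markov model is a tuple $\mathfrak{M}=\langle\Omega,\mathcal{A},T,f,v\rangle$, where $\langle\Omega,\mathcal{A}\rangle$ is a measurable space, $T:\Omega\times\mathcal{A}\to[0,1]$ is a Markov kernel ($T(w,\cdot)$ is a probability measure for each $w\in\Omega$, and $T(\cdot,A)$ is measurable for each $A\in\mathcal{A}$), $f:\Omega\to\Omega$ is measurable, and $v:\mathbb{P}\to\mathcal{A}$. It is finite if $\Omega$ is finite. Satisfaction at $w\in\Omega$ is defined by: $\mathfrak{M},w\vDash p$ iff $w\in v(p)$; the usual clauses for $\neg$ and $\wedge$; $\mathfrak{M},w\vDash L_r\varphi$ iff $T(w,\{x\in\Omega : \mathfrak{M},x\vDash\varphi\})\ge r$; and $\mathfrak{M},w\vDash\bigcirc\varphi$ iff $\mathfrak{M},f(w)\vDash\varphi$. A formula is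 satisfiable in $\mathfrak{M}$ if it holds at some $w\in\Omega$. Corollary (finite model property). If a $\mathsf{DPL}$ formula $\varphi$ is satisfiable in some dynamic Markov model, then it is satisfiable in some finite dynamic Markov model. -/

import Mathlib

open MeasureTheory ProbabilityTheory

universe u v u₁ u₂

namespace DPL

/-- Formulas of dynamic probability logic over the propositional variables `P`. -/
inductive Formula (P : Type v) : Type v
  | var (p : P) : Formula P
  | neg (φ : Formula P) : Formula P
  | and (φ ψ : Formula P) : Formula P
  /-- `L_r φ`: the probability of `φ` is at least `r`, with `r` rational in `[0, 1]`. -/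
  | prob (r : Set.Icc (0 : ℚ) 1) (φ : Formula P) : Formula P
  /-- `○ φ`: the formula `φ` holds at the next instance of time. -/
  | next (φ : Formula P) : Formula P

/-- A dynamic Markov model: a measurable space with a Markov kernel, a measurable self-map
and a valuation of the propositional variables by measurable sets. -/
structure Model (P : Type v) where
  Ω : Type u
  [measurableSpace : MeasurableSpace Ω]
  T : Kernel Ω Ω
  [isMarkov : IsMarkovKernel T]
  f : Ω → Ω
  measurable_f : Measurable f
  val : P → Set Ω
  measurableSet_val : ∀ p, MeasurableSet (val p)

attribute [instance] Model.measurableSpace Model.isMarkov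

/-- `M.Sat φ w`: the formula `φ` holds at the world `w` of `M`. -/
def Model.Sat {P : Type v} (M : Model.{u, v} P) : Formula P → M.Ω → Prop
  | .var p, w => w ∈ M.val p
  | .neg φ, w => ¬ M.Sat φ w
  | .and φ ψ, w => M.Sat φ w ∧ M.Sat ψ w
  | .prob r φ, w => ((r : ℚ) : ℝ) ≤ (M.T w).real {x | M.Sat φ x}
  | .next φ, w => M.Sat φ (M.f w)

/-- Truth sets are measurable, so that `T(w, ⟦φ⟧)` is a genuine probability. -/
theorem Model.measurableSet_sat {P : Type v} (M : Model.{u, v} P) (φ : Formula P) :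
    MeasurableSet {w | M.Sat φ w} := by
  induction φ with
  | var p => exact M.measurableSet_val p
  | neg φ ih => exact ih.compl
  | and φ ψ ih₁ ih₂ => exact ih₁.inter ih₂
  | prob r φ ih =>
    exact measurableSet_le measurable_const (M.T.measurable_coe ih).ennreal_toReal
  | next φ ih => exact M.measurable_f ih

/-- `φ` holds at some world of some dynamic Markov model. -/
def Satisfiable {P : Type v} (φ : Formula P) : Prop :=
  ∃ (M : Model.{u, v} P) (w : M.Ω), M.Sat φ w

/-- `φ` holds at some world of some dynamic Markov model with finitely many worlds. -/
def FinitelySatisfiable {P : Type v} (φ : Formula P) : Prop :=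
  ∃ M : Model.{u, v} P, Finite M.Ω ∧ ∃ w : M.Ω, M.Sat φ w

end DPL

namespace DPL

/-! Filtration: worlds that agree on the finitely many subformulas of `φ` are identified, and each
class moves by the kernel and map of one chosen representative, pushed down to classes. Truth of a
subformula depends only on the class, so its truth set is a union of classes and keeps its
probability; this drives `Model.sat_filtration_iff`. -/

/-- The set of subformulas of a formula, including the formula itself. -/
def Formula.subformulas {P : Type v} : Formula P → Set (Formula P)
  | .var p => {.var p}
  | .neg φ => insert (.neg φ) φ.subformulas
  | .and φ ψ => insert (.and φ ψ) (φ.subformulas ∪ ψ.subformulas)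
  | .prob r φ => insert (.prob r φ) φ.subformulas
  | .next φ => insert (.next φ) φ.subformulas

theorem Formula.mem_subformulas_self {P : Type v} (φ : Formula P) : φ ∈ φ.subformulas := by
  cases φ <;> simp [subformulas]

theorem Formula.finite_subformulas {P : Type v} (φ : Formula P) : φ.subformulas.Finite := by
  induction φ with
  | var p => exact Set.finite_singleton _
  | neg φ ih => exact ih.insert _
  | and φ ψ ih₁ ih₂ => exact (ih₁.union ih₂).insert _
  | prob r φ ih => exact ih.insert _
  | next φ ih => exact ih.insert _

/-- The filtration of `M` along a measurable map `q : M.Ω → W` to a discrete space, with `s w`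
the world of `M` that represents `w`. -/
noncomputable def Model.filtration {P : Type v} (M : Model.{u₁, v} P) {W : Type u₂}
    [MeasurableSpace W] [DiscreteMeasurableSpace W] (q : M.Ω → W) (hq : Measurable q)
    (s : W → M.Ω) : Model.{u₂, v} P where
  Ω := W
  T := (M.T.comap s (Measurable.of_discrete (f := s))).map q
  isMarkov := Kernel.IsMarkovKernel.map _ hq
  f := fun w => q (M.f (s w))
  measurable_f := .of_discrete
  val := fun p => s ⁻¹' M.val p
  measurableSet_val := fun _ => .of_discrete

theorem Model.filtration_real_apply {P : Type v} (M : Model.{u₁, v} P) {W : Type u₂}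
    [MeasurableSpace W] [DiscreteMeasurableSpace W] {q : M.Ω → W} (hq : Measurable q)
    (s : W → M.Ω) (w : W) (A : Set W) :
    Measure.real ((M.filtration q hq s).T w) A = (M.T (s w)).real (q ⁻¹' A) := by
  change (((M.T.comap s (Measurable.of_discrete (f := s))).map q) w).real A = _
  rw [Kernel.map_apply _ hq, Kernel.comap_apply, map_measureReal_apply hq .of_discrete]

/-- Truth lemma: if representatives agree with the worlds they represent on all subformulas of
`ψ`, then the filtration satisfies `ψ` at `w` iff the representative of `w` does. -/
theorem Model.sat_filtration_iff {P : Type v} (M : Model.{u₁, v} P) {W : Type u₂}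
    [MeasurableSpace W] [DiscreteMeasurableSpace W] {q : M.Ω → W} (hq : Measurable q)
    {s : W → M.Ω} (ψ : Formula P)
    (hs : ∀ χ ∈ ψ.subformulas, ∀ x, M.Sat χ (s (q x)) ↔ M.Sat χ x) (w : W) :
    (M.filtration q hq s).Sat ψ w ↔ M.Sat ψ (s w) := by
  induction ψ generalizing w with
  | var p => exact Iff.rfl
  | neg φ ih => exact not_congr (ih (fun χ h => hs χ (.inr h)) w)
  | and φ ψ ih₁ ih₂ =>
    exact and_congr (ih₁ (fun χ h => hs χ (.inr (.inl h))) w)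
      (ih₂ (fun χ h => hs χ (.inr (.inr h))) w)
  | prob r φ ih =>
    have hφ := ih fun χ h => hs χ (.inr h)
    have hpre : q ⁻¹' {x | (M.filtration q hq s).Sat φ x} = {x | M.Sat φ x} :=
      Set.ext fun x => (hφ (q x)).trans (hs φ (.inr φ.mem_subformulas_self) x)
    have hT : ((M.filtration q hq s).T w).real {x | (M.filtration q hq s).Sat φ x} =
        (M.T (s w)).real {x | M.Sat φ x} := by
      rw [← hpre]
      exact M.filtration_real_apply hq s w _
    change _ ≤ _ ↔ _ ≤ _
    rw [hT]
  | next φ ih =>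
    -- The successor of `w` is represented by `s (q (M.f (s w)))`, possibly not `M.f (s w)` itself,
    -- but the two agree on `φ`.
    exact (ih (fun χ h => hs χ (.inr h)) _).trans
      (hs φ (.inr φ.mem_subformulas_self) (M.f (s w)))

/-- There is a measurable map to a finite discrete space, in any universe, that separates the
worlds which disagree on one of finitely many formulas. -/
theorem Model.exists_finite_separating_map {P : Type v} (M : Model.{u₁, v} P)
    {S : Set (Formula P)} (hS : S.Finite) :
    ∃ (n : ℕ) (q : M.Ω → ULift.{u₂} (Fin n)), Measurable q ∧
      ∀ x y, q x = q y → ∀ χ ∈ S, M.Sat χ x ↔ M.Sat χ y := by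
  have : Finite S := hS
  -- Worlds are coded by their truth assignment on `S`.
  let e := Finite.equivFin (S → Prop)
  refine ⟨_, fun x => ULift.up (e fun χ : S => M.Sat χ x), ?_, fun x y h χ hχ => ?_⟩
  · refine measurable_up.comp ((measurable_of_countable e).comp ?_)
    exact measurable_pi_lambda _ fun χ => measurableSet_setOfPred.1 (M.measurableSet_sat χ)
  · exact (congrFun (e.injective (ULift.up_injective h)) ⟨χ, hχ⟩).to_iff

end DPL

theorem mainTheorem2 {P : Type v} [Countable P] (φ : DPL.Formula P)
    (hφ : DPL.Satisfiable.{u₁, v} φ) : DPL.FinitelySatisfiable.{u₂, v} φ := by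
  obtain ⟨M, x, hx⟩ := hφ
  obtain ⟨n, q, hq, hsep⟩ := M.exists_finite_separating_map.{v, u₁, u₂} φ.finite_subformulas
  have : Nonempty M.Ω := ⟨x⟩
  have : DiscreteMeasurableSpace (ULift.{u₂} (Fin n)) :=
    MeasurableSingletonClass.toDiscreteMeasurableSpace
  -- Codes outside the range of `q` get an arbitrary representative; agreement is needed only at
  -- codes `q y`.
  have hs : ∀ χ ∈ φ.subformulas, ∀ y, M.Sat χ (Function.invFun q (q y)) ↔ M.Sat χ y :=
    fun χ hχ y => hsep _ _ (Function.invFun_eq ⟨y, rfl⟩) χ hχ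
  refine ⟨M.filtration q hq (Function.invFun q), inferInstanceAs (Finite (ULift (Fin n))), q x, ?_⟩
  exact (M.sat_filtration_iff hq φ hs (q x)).2 ((hs φ φ.mem_subformulas_self x).2 hx)
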